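/- Let $(\mathcal A,\otimes,\mathbb 1)$ be a monoidal category (unit and associativity isomorphisms are suppressed below) and let $\mathbb B=(B,\mu,\eta)$ be an opmonoidal monad on $\mathcal A$ with constraints $B_2(X,Y)\colon B(X\otimes Y)\to BX\otimes BY$ and $B_0\colon B\mathbb 1\to\mathbb 1$, that is, $B$ is an opmonoidal functor and $\mu,\eta$ are opmonoidal natural transformations. Let $F\colon\mathcal A\rightleftarrows\mathcal A^{\mathbb B}\colon U$ be its Eilenberg–Moore adjunction and $\mathbb T$ the induced comonad on $\mathcal A^{\mathbb B}$, with $T=FU$. Assume that * $\mathbb B$ is a pre-Hopf monad: for every object $X$, the fusion operators $H^l_{\mathbb 1,X}=(B\mathbb 1\otimes\mu_X)\,B_2(\mathbb 1,BX)\colon B(\mathbb 1\otimes BX)\to B\mathbb 1\otimes BX$ and $H^r_{\mathbb 1,X}=(\mu_{\mathbb 1}\otimes BX)\,B_2(B\mathbb 1,X)\colon B(B\mathbb 1\otimes X)\to B\mathbb 1\otimes BX$ are isomorphisms; and * $F$ is comonadic: the comparison functor $\mathcal A\to(\mathcal A^{\mathbb B})_{\mathbb T}$ to the category of $\mathbb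 T$-coalgebras is an equivalence. Let $\mathbb C$ be the comonad on $\mathcal A$ with $C=B\mathbb 1\otimes-$, comultiplication $B_2(\mathbb 1,\mathbb 1)\otimes X$ and counit $B_0\otimes X$, and let $\theta_X=H^r_{\mathbb 1,X}\colon BC X\to CBX$, which is a mixed distributive law of $\mathbb B$ over $\mathbb C$. Let $\mathbb C^\theta$ be the lift of $\mathbb C$ to $\mathcal A^{\mathbb B}$, $C^\theta(X,\alpha)=(CX,\,C(\alpha)\theta_X)$, with the comultiplication and counit of $\mathbb C$. Let $\chi\colon TC^\theta\Rightarrow C^\theta T$ be the distributive law of $\mathbb T$ over $\mathbb C^\theta$ induced by this lift: $\chi=\Lambda U$, where $\Lambda\colon FC\Rightarrow C^\theta F$ is the mate of the identity $CU= UC^\theta$ under $F\dashv U$; explicitly $\chi_{(X,\alpha)}=\theta_X$. Let $V\colon(\mathcal A^{\mathbb B})_{\mathbb C^\theta}\to\mathcal A^{\mathbb B}$ be the forgetful functor from the category of $\mathbb C^\theta$-coalgebras, and let $\mathbb T^\theta$ be the comonad on $(\mathcal A^{\mathbb B})_{\mathbb C^\theta}$ given by $T^\theta((X,\alpha),\delta)=(T(X,\alpha),\,\chi_{(X,\alpha)}T(\delta))$,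 with the comultiplication and counit of $\mathbb T$. Finally let $K\colon\mathcal A\to(\mathcal A^{\mathbb B})_{\mathbb C^\theta}$ be the functor $K(X)=(F X,\,B_2(\mathbb 1,X))$, $K(f)=F(f)$, so that $VK=F$. Then $K$ is an equivalence of categories. Moreover, let $\bar K$ be any quasi-inverse of $K$, let $\xi\colon K\bar K\Rightarrow\mathrm{id}$ and $\phi\colon\mathrm{id}\Rightarrow\bar KK$ be the counit and unit of an adjunction $K\dashv\bar K$, and let $\overline{\mathbb T^\theta}$ be the conjugate comonad on $\mathcal A$, with underlying functor $\bar KT^\theta K$, comultiplication $\bar KT^\theta\xi^{-1}T^\theta K\circ\bar K\Delta^{\mathbb T^\theta}K$ and counit $\phi^{-1}\circ\bar K\varepsilon^{\mathbb T^\theta}K$. Then for every category $\mathcal Z$ and every functor $N\colon\mathcal A^{\mathbb B}\to\mathcal Z$ the assignment $\lambda\mapsto\overline{\nabla}$, $$\overline{\nabla}_X=\Bigl(NFX\xrightarrow{N(B_2(\mathbb 1,X))}NC^\theta FX\xrightarrow{\lambda_{FX}}NTFX=NVT^\theta KX\xrightarrow{NV\xi^{-1}_{T^\theta KX}}NF\bar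 KT^\theta KX\Bigr),$$ is a bijection from the set of left $\chi$-coalgebra structures on $N$, that is, natural transformations $\lambda\colon NC^\theta\Rightarrow NT$ with $$N\Delta^{\mathbb T}\circ\lambda=\lambda T\circ N\chi\circ\lambda C^\theta\circ N\Delta^{\mathbb C^\theta},\qquad N\varepsilon^{\mathbb T}\circ\lambda=N\varepsilon^{\mathbb C^\theta},$$ onto the set of $\overline{\mathbb T^\theta}$-opcoalgebra structures on $NF$, that is, natural transformations $\gamma\colon NF\Rightarrow NF\,\overline{T^\theta}$ with $$NF\Delta^{\overline{\mathbb T^\theta}}\circ\gamma=\gamma\,\overline{T^\theta}\circ\gamma,\qquad NF\varepsilon^{\overline{\mathbb T^\theta}}\circ\gamma=\mathrm{id}_{NF}.$$ -/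

import Mathlib

open CategoryTheory MonoidalCategory

universe v₁ v₂ v₃ u₁ u₂ u₃

namespace HopfMonads

section General

/-! ### Coalgebras and opcoalgebras -/

/-- `γ : M ⇒ M C` is a `C`-opcoalgebra structure on the functor `M`:
`M Δ ∘ γ = γ C ∘ γ` and `M ε ∘ γ = id`. -/
structure IsOpcoalgebra {C : Type u₁} [Category.{v₁} C] {Z : Type u₂} [Category.{v₂} Z]
    (Q : Comonad C) (M : C ⥤ Z) (γ : M ⟶ Q.toFunctor ⋙ M) : Prop where
  coassoc (X : C) :
    γ.app X ≫ M.map (Q.δ.app X) = γ.app X ≫ γ.app (Q.obj X)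
  counit (X : C) : γ.app X ≫ M.map (Q.ε.app X) = 𝟙 (M.obj X)

/-- For comonads `T`, `S` and a natural transformation `χ : T S ⇒ S T` (a distributive law),
`l : N S ⇒ N T` is a left `χ`-coalgebra structure on the functor `N`:
`N Δ^T ∘ l = l T ∘ N χ ∘ l S ∘ N Δ^S` and `N ε^T ∘ l = N ε^S`. -/
structure IsLeftCoalgebra {D : Type u₁} [Category.{v₁} D] {Z : Type u₂} [Category.{v₂} Z]
    {T S : Comonad D} (χ : S.toFunctor ⋙ T.toFunctor ⟶ T.toFunctor ⋙ S.toFunctor)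
    (N : D ⥤ Z) (l : S.toFunctor ⋙ N ⟶ T.toFunctor ⋙ N) : Prop where
  comul (X : D) :
    l.app X ≫ N.map (T.δ.app X) =
      N.map (S.δ.app X) ≫ l.app (S.obj X) ≫ N.map (χ.app X) ≫ l.app (T.obj X)
  counit (X : D) : l.app X ≫ N.map (T.ε.app X) = N.map (S.ε.app X)

/-! ### Conjugate comonads -/

/-- The conjugate comonad `K' Q K` of a comonad `Q` under an adjunction `K' ⊣ K`. When `K` is an
equivalence with quasi-inverse `K'`, and `ξ`, `φ` are the counit and unit of `K ⊣ K'`, the unit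
and counit of `K' ⊣ K` are `ξ⁻¹` and `φ⁻¹`. -/
def conjugateComonad {A : Type u₁} [Category.{v₁} A] {C : Type u₂} [Category.{v₂} C]
    {K' : C ⥤ A} {K : A ⥤ C} (adj : K' ⊣ K) (Q : Comonad C) : Comonad A where
  toFunctor := K ⋙ Q.toFunctor ⋙ K'
  ε :=
    { app := fun X => K'.map (Q.ε.app (K.obj X)) ≫ adj.counit.app X
      naturality := fun X Y f => by
        have := Q.ε.naturality (K.map f)
        dsimp at this ⊢
        rw [← K'.map_comp_assoc, this]
        simp }
  δ :=
    { app := fun X => K'.map (Q.δ.app (K.obj X)) ≫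
        K'.map (Q.map (adj.unit.app (Q.obj (K.obj X))))
      naturality := fun X Y f => by
        have h := Q.δ.naturality (K.map f)
        have h' := adj.unit.naturality (Q.map (K.map f))
        dsimp at h h' ⊢
        simp only [← K'.map_comp, ← Category.assoc]
        rw [h]
        simp only [Category.assoc, ← Q.map_comp]
        rw [h'] }
  coassoc X := by
    have h := Q.δ.naturality (adj.unit.app (Q.obj (K.obj X)))
    have h2 := adj.unit.naturality (Q.δ.app (K.obj X))
    have h3 := adj.unit.naturality (Q.map (adj.unit.app (Q.obj (K.obj X))))
    dsimp at h h2 h3 ⊢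
    simp only [← K'.map_comp]
    congr 1
    simp only [Category.assoc, ← Q.map_comp, K.map_comp, K'.map_comp]
    rw [reassoc_of% h, ← Q.map_comp, h3, ← reassoc_of% h2, Q.map_comp, Q.coassoc_assoc]
  left_counit X := by
    have h := Q.ε.naturality (adj.unit.app (Q.obj (K.obj X)))
    dsimp at h ⊢
    simp only [← K'.map_comp_assoc, Category.assoc]
    rw [h]
    simp
  right_counit X := by
    have h := adj.unit.naturality (Q.ε.app (K.obj X))
    dsimp at h ⊢
    simp only [← K'.map_comp, Category.assoc, ← Q.map_comp, K.map_comp]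
    rw [← reassoc_of% h]
    simp

/-! ### Distributive laws from adjunctions -/

section Adj

variable {A : Type u₁} [Category.{v₁} A] {D : Type u₂} [Category.{v₂} D]
  {F : A ⥤ D} {U : D ⥤ A}

/-- The mate `Λ = ε S F ∘ F Ω F ∘ F C η : F C ⇒ S F` of `Ω : C U ⇒ U S` under `F ⊣ U`. -/
def mate (adj : F ⊣ U) {C : A ⥤ A} {S : D ⥤ D} (Ω : U ⋙ C ⟶ S ⋙ U) : C ⋙ F ⟶ F ⋙ S where
  app X := F.map (C.map (adj.unit.app X)) ≫ F.map (Ω.app (F.obj X)) ≫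
    adj.counit.app (S.obj (F.obj X))
  naturality X Y f := by
    have h := adj.unit.naturality f
    have h2 := Ω.naturality (F.map f)
    dsimp at h h2 ⊢
    rw [← F.map_comp_assoc, ← C.map_comp, h, C.map_comp, F.map_comp_assoc,
      ← F.map_comp_assoc (C.map (U.map (F.map f))), h2]
    simp

/-- The transformation `χ = Λ U ∘ F Ω⁻¹ : T S ⇒ S T` for `T = F U` induced by an isomorphism
`Ω : C U ≅ U S` with mate `Λ`. -/
def inducedLaw (adj : F ⊣ U) {C : A ⥤ A} {S : D ⥤ D} (Ω : U ⋙ C ≅ S ⋙ U) :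
    S ⋙ adj.toComonad.toFunctor ⟶ adj.toComonad.toFunctor ⋙ S where
  app X := F.map (Ω.inv.app X) ≫ (mate adj Ω.hom).app (U.obj X)
  naturality X Y f := by
    have h := Ω.inv.naturality f
    have h2 := (mate adj Ω.hom).naturality (U.map f)
    dsimp at h h2
    change F.map (U.map (S.map f)) ≫ F.map (Ω.inv.app Y) ≫ (mate adj Ω.hom).app (U.obj Y) =
      (F.map (Ω.inv.app X) ≫ (mate adj Ω.hom).app (U.obj X)) ≫ S.map (F.map (U.map f))
    rw [← F.map_comp_assoc, h, F.map_comp_assoc, h2, Category.assoc]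

end Adj

/-! ### Mixed distributive laws, the lifted comonad, and entwined coalgebras -/

variable {A : Type u₁} [Category.{v₁} A]

/-- A mixed distributive law `θ : B C ⇒ C B` of a monad `B` over a comonad `C`. The first two
axioms say that `(C, θ)` is a lax endomorphism of `B`, the last two that `(B, θ)` is a colax
endomorphism of `C`. -/
structure MixedDistributiveLaw (B : Monad A) (C : Comonad A) where
  hom : C.toFunctor ⋙ B.toFunctor ⟶ B.toFunctor ⋙ C.toFunctor
  mul (X : A) : B.μ.app (C.obj X) ≫ hom.app X =
    B.map (hom.app X) ≫ hom.app (B.obj X) ≫ C.map (B.μ.app X)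
  unit (X : A) : B.η.app (C.obj X) ≫ hom.app X = C.map (B.η.app X)
  comul (X : A) : hom.app X ≫ C.δ.app (B.obj X) =
    B.map (C.δ.app X) ≫ hom.app (C.obj X) ≫ C.map (hom.app X)
  counit (X : A) : hom.app X ≫ C.ε.app (B.obj X) = B.map (C.ε.app X)

variable {B : Monad A} {C : Comonad A}

/-- The lift `C^θ` of `C` to the category of `B`-algebras:
`C^θ (X, α) = (C X, C α ∘ θ_X)`, with the comultiplication and counit of `C`. -/
def liftComonad (θ : MixedDistributiveLaw B C) : Comonad B.Algebra where
  obj X :=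
    { A := C.obj X.A
      a := θ.hom.app X.A ≫ C.map X.a
      unit := by
        rw [← Category.assoc, θ.unit, ← C.map_comp, X.unit]
        exact C.map_id X.A
      assoc := by
        have h := θ.hom.naturality X.a
        dsimp at h ⊢
        rw [← Category.assoc, θ.mul]
        simp only [Category.assoc, ← C.map_comp, X.assoc, B.map_comp]
        rw [reassoc_of% h, C.map_comp] }
  map {X Y} f :=
    { f := C.map f.f
      h := by
        have h := θ.hom.naturality f.f
        dsimp at h ⊢
        rw [reassoc_of% h, ← C.map_comp, f.h, C.map_comp, Category.assoc] }
  map_id X := by ext; simp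
  map_comp f g := by ext; simp
  ε :=
    { app := fun X =>
        { f := C.ε.app X.A
          h := by
            have h := C.ε.naturality X.a
            dsimp at h ⊢
            rw [Category.assoc, h, ← θ.counit, Category.assoc] }
      naturality := fun X Y f => by
        ext
        exact C.ε.naturality f.f }
  δ :=
    { app := fun X =>
        { f := C.δ.app X.A
          h := by
            have h := C.δ.naturality X.a
            dsimp at h ⊢
            rw [Category.assoc, h, reassoc_of% (θ.comul X.A), C.map_comp] }
      naturality := fun X Y f => by
        ext
        exact C.δ.naturality f.f }
  coassoc X := by
    ext
    exact C.coassoc X.A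
  left_counit X := by
    ext
    exact C.left_counit X.A
  right_counit X := by
    ext
    exact C.right_counit X.A

/-- The identity transformation `Ω : C U ≅ U C^θ` exhibiting `C^θ` as a lift of `C` through the
Eilenberg–Moore adjunction. -/
def liftIso (θ : MixedDistributiveLaw B C) :
    B.forget ⋙ C.toFunctor ≅ (liftComonad θ).toFunctor ⋙ B.forget :=
  NatIso.ofComponents (fun X => Iso.refl (C.obj X.A)) (fun f =>
    (Category.comp_id (C.map f.f)).trans (Category.id_comp (C.map f.f)).symm)

/-- The comonad `T = F U` on `B`-algebras induced by the Eilenberg–Moore adjunction `F ⊣ U`. -/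
abbrev freeComonad (B : Monad A) : Comonad B.Algebra := B.adj.toComonad

/-- The distributive law `χ : T C^θ ⇒ C^θ T` induced by `Ω`. -/
def chi (θ : MixedDistributiveLaw B C) :
    (liftComonad θ).toFunctor ⋙ (freeComonad B).toFunctor ⟶
      (freeComonad B).toFunctor ⋙ (liftComonad θ).toFunctor :=
  inducedLaw B.adj (liftIso θ)

theorem adj_unit_app (B : Monad A) (X : A) : B.adj.unit.app X = B.η.app X := by
  rw [Monad.adj_unit]

theorem adj_counit_app_f (B : Monad A) (X : B.Algebra) : (B.adj.counit.app X).f = X.a := by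
  rw [Monad.adj_counit]

theorem chi_app_f (θ : MixedDistributiveLaw B C) (X : B.Algebra) :
    ((chi θ).app X).f = θ.hom.app X.A := by
  have h0 : ((chi θ).app X).f = B.map (𝟙 (C.obj X.A)) ≫ B.map (C.map (B.adj.unit.app X.A)) ≫
      B.map (𝟙 (C.obj (B.obj X.A))) ≫
      (B.adj.counit.app ((liftComonad θ).obj (B.free.obj X.A))).f := rfl
  have h1 : (B.adj.counit.app ((liftComonad θ).obj (B.free.obj X.A))).f =
      θ.hom.app (B.obj X.A) ≫ C.map (B.μ.app X.A) := adj_counit_app_f B _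
  have h := θ.hom.naturality (B.η.app X.A)
  dsimp at h
  have h2 : θ.hom.app X.A ≫ C.map (B.map (B.η.app X.A)) ≫ C.map (B.μ.app X.A) =
      θ.hom.app X.A := by
    rw [← C.map_comp, B.right_unit]
    exact (congrArg _ (C.map_id _)).trans (Category.comp_id _)
  have h3 : B.map (C.map (B.adj.unit.app X.A)) = B.map (C.map (B.η.app X.A)) :=
    congrArg (fun t => B.map (C.map t)) (adj_unit_app B X.A)
  rw [h0, h1, h3, B.map_id, Category.id_comp]
  refine Eq.trans ?_ h2
  rw [← reassoc_of% h]
  refine congrArg (B.map (C.map (B.η.app X.A)) ≫ ·) ?_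
  refine (congrArg (· ≫ _) (B.map_id _)).trans (Category.id_comp _)

section Aux

variable (θ : MixedDistributiveLaw B C) {X Y : A}

theorem aux_counit (d : X ⟶ C.obj X) (h : d ≫ C.ε.app X = 𝟙 X) :
    (B.map d ≫ θ.hom.app X) ≫ C.ε.app (B.obj X) = 𝟙 (B.obj X) := by
  rw [Category.assoc, θ.counit]
  exact (B.map_comp _ _).symm.trans ((congrArg _ h).trans (B.map_id _))

theorem aux_coassoc (d : X ⟶ C.obj X) (h : d ≫ C.δ.app X = d ≫ C.map d) :
    (B.map d ≫ θ.hom.app X) ≫ C.δ.app (B.obj X) =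
      (B.map d ≫ θ.hom.app X) ≫ C.map (B.map d ≫ θ.hom.app X) := by
  have h2 : B.map (C.map d) ≫ θ.hom.app (C.obj X) =
    θ.hom.app X ≫ C.map (B.map d) := θ.hom.naturality d
  have h3 : B.map d ≫ B.map (C.δ.app X) = B.map d ≫ B.map (C.map d) :=
    (B.map_comp _ _).symm.trans ((congrArg _ h).trans (B.map_comp _ _))
  have h4 : C.map (B.map d ≫ θ.hom.app X) =
    C.map (B.map d) ≫ C.map (θ.hom.app X) := C.map_comp _ _
  rw [Category.assoc, θ.comul, reassoc_of% h3, reassoc_of% h2, h4, Category.assoc]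

theorem aux_map (d : X ⟶ C.obj X) (e : Y ⟶ C.obj Y) (f : X ⟶ Y)
    (h : d ≫ C.map f = f ≫ e) :
    (B.map d ≫ θ.hom.app X) ≫ C.map (B.map f) = B.map f ≫ B.map e ≫ θ.hom.app Y := by
  have h2 : B.map (C.map f) ≫ θ.hom.app Y = θ.hom.app X ≫ C.map (B.map f) :=
    θ.hom.naturality f
  have h3 : B.map d ≫ B.map (C.map f) = B.map f ≫ B.map e :=
    (B.map_comp _ _).symm.trans ((congrArg _ h).trans (B.map_comp _ _))
  rw [Category.assoc, ← h2, reassoc_of% h3]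

theorem aux_comul (d : X ⟶ C.obj X) :
    (B.map d ≫ θ.hom.app X) ≫ C.map (B.map (B.η.app X)) =
      B.map (B.η.app X) ≫ B.map (B.map d ≫ θ.hom.app X) ≫ θ.hom.app (B.obj X) := by
  have h : d ≫ B.η.app (C.obj X) = B.η.app X ≫ B.map d := B.η.naturality d
  have h2 : B.map (C.map (B.η.app X)) ≫ θ.hom.app (B.obj X) =
    θ.hom.app X ≫ C.map (B.map (B.η.app X)) := θ.hom.naturality (B.η.app X)
  have h5 : B.η.app X ≫ B.map d ≫ θ.hom.app X = d ≫ C.map (B.η.app X) := by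
    rw [← reassoc_of% h, θ.unit]
  have h6 : B.map (B.η.app X) ≫ B.map (B.map d ≫ θ.hom.app X) =
      B.map d ≫ B.map (C.map (B.η.app X)) :=
    (B.map_comp _ _).symm.trans ((congrArg _ h5).trans (B.map_comp _ _))
  rw [Category.assoc, reassoc_of% h6, h2]

end Aux

/-- The coaction on `T^θ ((X, α), δ)`. -/
def extensionCoaction (θ : MixedDistributiveLaw B C) (Y : (liftComonad θ).Coalgebra) :
    (freeComonad B).obj Y.A ⟶ (liftComonad θ).obj ((freeComonad B).obj Y.A) :=
  (freeComonad B).map Y.a ≫ (chi θ).app Y.A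

theorem extensionCoaction_f (θ : MixedDistributiveLaw B C) (Y : (liftComonad θ).Coalgebra) :
    (extensionCoaction θ Y).f = B.map Y.a.f ≫ θ.hom.app Y.A.A :=
  congrArg (B.map Y.a.f ≫ ·) (chi_app_f θ Y.A)

/-- The comonad `T^θ` on the category of entwined coalgebras (coalgebras over `C^θ`):
`T^θ ((X, α), δ) = (T (X, α), χ_{(X, α)} ∘ T δ)`, with the comultiplication and counit of `T`. -/
def extensionComonad (θ : MixedDistributiveLaw B C) : Comonad (liftComonad θ).Coalgebra where
  obj Y :=
    { A := (freeComonad B).obj Y.A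
      a := extensionCoaction θ Y
      counit := by
        apply Monad.Algebra.Hom.ext
        change (extensionCoaction θ Y).f ≫ C.ε.app (B.obj Y.A.A) = 𝟙 (B.obj Y.A.A)
        rw [extensionCoaction_f]
        exact aux_counit θ Y.a.f (congrArg Monad.Algebra.Hom.f Y.counit)
      coassoc := by
        apply Monad.Algebra.Hom.ext
        change (extensionCoaction θ Y).f ≫ C.δ.app (B.obj Y.A.A) =
          (extensionCoaction θ Y).f ≫ C.map (extensionCoaction θ Y).f
        rw [extensionCoaction_f]
        exact aux_coassoc θ Y.a.f (congrArg Monad.Algebra.Hom.f Y.coassoc) }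
  map {Y Z} f :=
    { f := (freeComonad B).map f.f
      h := by
        apply Monad.Algebra.Hom.ext
        change (extensionCoaction θ Y).f ≫ C.map (B.map f.f.f) =
          B.map f.f.f ≫ (extensionCoaction θ Z).f
        rw [extensionCoaction_f, extensionCoaction_f]
        exact aux_map θ Y.a.f Z.a.f f.f.f (congrArg Monad.Algebra.Hom.f f.h) }
  map_id Y := Comonad.Coalgebra.Hom.ext ((freeComonad B).map_id Y.A)
  map_comp f g := Comonad.Coalgebra.Hom.ext ((freeComonad B).map_comp f.f g.f)
  ε :=
    { app := fun Y =>
        { f := (freeComonad B).ε.app Y.A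
          h := by
            apply Monad.Algebra.Hom.ext
            change (extensionCoaction θ Y).f ≫ C.map (B.adj.counit.app Y.A).f =
              (B.adj.counit.app Y.A).f ≫ Y.a.f
            rw [extensionCoaction_f, adj_counit_app_f]
            exact (Category.assoc _ _ _).trans Y.a.h }
      naturality := fun _ _ f => Comonad.Coalgebra.Hom.ext ((freeComonad B).ε.naturality f.f) }
  δ :=
    { app := fun Y =>
        { f := (freeComonad B).δ.app Y.A
          h := by
            apply Monad.Algebra.Hom.ext
            change (extensionCoaction θ Y).f ≫ C.map (B.map (B.adj.unit.app Y.A.A)) =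
              B.map (B.adj.unit.app Y.A.A) ≫ B.map (extensionCoaction θ Y).f ≫
                ((chi θ).app ((freeComonad B).obj Y.A)).f
            have h3 : B.adj.unit.app Y.A.A = B.η.app Y.A.A := adj_unit_app B _
            have h4 : ((chi θ).app ((freeComonad B).obj Y.A)).f = θ.hom.app (B.obj Y.A.A) :=
              chi_app_f θ _
            rw [h3, h4, extensionCoaction_f]
            exact aux_comul θ Y.a.f }
      naturality := fun _ _ f => Comonad.Coalgebra.Hom.ext ((freeComonad B).δ.naturality f.f) }
  coassoc Y := Comonad.Coalgebra.Hom.ext ((freeComonad B).coassoc Y.A)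
  left_counit Y := Comonad.Coalgebra.Hom.ext ((freeComonad B).left_counit Y.A)
  right_counit Y := Comonad.Coalgebra.Hom.ext ((freeComonad B).right_counit Y.A)

/-! ### The correspondence of coalgebra structures -/

/-- The transformation `∇ = l V ∘ N V η' : N V ⇒ N V T^θ` associated with `l : N C^θ ⇒ N T`, where
`V` is the forgetful functor on entwined coalgebras, with `V T^θ = T V`, and
`η'_{(X, α), δ} = δ` is the unit of the forgetful-cofree adjunction. -/
def nabla (θ : MixedDistributiveLaw B C) {Z : Type u₃} [Category.{v₃} Z] (N : B.Algebra ⥤ Z)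
    (l : (liftComonad θ).toFunctor ⋙ N ⟶ (freeComonad B).toFunctor ⋙ N) :
    (liftComonad θ).forget ⋙ N ⟶
      (extensionComonad θ).toFunctor ⋙ (liftComonad θ).forget ⋙ N where
  app Y := N.map Y.a ≫ l.app Y.A
  naturality Y Y' f := by
    have h := l.naturality f.f
    change N.map f.f ≫ N.map Y'.a ≫ l.app Y'.A =
      (N.map Y.a ≫ l.app Y.A) ≫ N.map ((freeComonad B).map f.f)
    change N.map ((liftComonad θ).map f.f) ≫ l.app Y'.A =
      l.app Y.A ≫ N.map ((freeComonad B).map f.f) at h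
    rw [Category.assoc, ← h, ← N.map_comp_assoc, ← N.map_comp_assoc, f.h]

/-- The transformation `M ξ⁻¹ Q K ∘ ∇ K : M K ⇒ M K (K' Q K)` associated with `∇ : M ⇒ M Q`,
where `ξ⁻¹` is the unit of `K' ⊣ K`. -/
def conjugateNabla {E : Type u₂} [Category.{v₂} E] {Z : Type u₃} [Category.{v₃} Z]
    {K' : E ⥤ A} {K : A ⥤ E} (adj : K' ⊣ K) (Q : Comonad E) (M : E ⥤ Z)
    (n : M ⟶ Q.toFunctor ⋙ M) :
    K ⋙ M ⟶ (conjugateComonad adj Q).toFunctor ⋙ K ⋙ M where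
  app X := n.app (K.obj X) ≫ M.map (adj.unit.app (Q.obj (K.obj X)))
  naturality X Y f := by
    have h : M.map (K.map f) ≫ n.app (K.obj Y) =
      n.app (K.obj X) ≫ M.map (Q.map (K.map f)) := n.naturality (K.map f)
    have h' : Q.map (K.map f) ≫ adj.unit.app (Q.obj (K.obj Y)) =
      adj.unit.app (Q.obj (K.obj X)) ≫ K.map (K'.map (Q.map (K.map f))) :=
        adj.unit.naturality (Q.map (K.map f))
    change M.map (K.map f) ≫ n.app (K.obj Y) ≫ M.map (adj.unit.app (Q.obj (K.obj Y))) =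
      (n.app (K.obj X) ≫ M.map (adj.unit.app (Q.obj (K.obj X)))) ≫
        M.map (K.map (K'.map (Q.map (K.map f))))
    rw [reassoc_of% h, Category.assoc, ← M.map_comp, ← M.map_comp, h']

end General

/-! ### Opmonoidal monads -/

section Opmonoidal

open Functor.OplaxMonoidal

variable {A : Type u₁} [Category.{v₁} A] [MonoidalCategory A]

/-- A monad whose underlying functor is opmonoidal (with constraints `B_2 = δ` and `B_0 = η`) is
an opmonoidal monad if its multiplication and unit are opmonoidal natural transformations. -/
class IsOpmonoidal (B : Monad A) [B.toFunctor.OplaxMonoidal] : Prop where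
  mul_tensor (X Y : A) : B.μ.app (X ⊗ Y) ≫ δ B.toFunctor X Y =
    B.map (δ B.toFunctor X Y) ≫ δ B.toFunctor (B.obj X) (B.obj Y) ≫ (B.μ.app X ⊗ₘ B.μ.app Y)
  mul_unit : B.μ.app (𝟙_ A) ≫ η B.toFunctor = B.map (η B.toFunctor) ≫ η B.toFunctor
  unit_tensor (X Y : A) : B.η.app (X ⊗ Y) ≫ δ B.toFunctor X Y = B.η.app X ⊗ₘ B.η.app Y
  unit_unit : B.η.app (𝟙_ A) ≫ η B.toFunctor = 𝟙 (𝟙_ A)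

variable (B : Monad A) [B.toFunctor.OplaxMonoidal]

/-- The left fusion operator `H^l_{X,Y} : B (X ⊗ B Y) ⟶ B X ⊗ B Y`. -/
def leftFusion (X Y : A) : B.obj (X ⊗ B.obj Y) ⟶ B.obj X ⊗ B.obj Y :=
  δ B.toFunctor X (B.obj Y) ≫ B.obj X ◁ B.μ.app Y

/-- The right fusion operator `H^r_{X,Y} : B (B X ⊗ Y) ⟶ B X ⊗ B Y`. -/
def rightFusion (X Y : A) : B.obj (B.obj X ⊗ Y) ⟶ B.obj X ⊗ B.obj Y :=
  δ B.toFunctor (B.obj X) Y ≫ B.μ.app X ▷ B.obj Y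

/-- An opmonoidal monad is pre-Hopf if `H^l_{𝟙,-}` and `H^r_{𝟙,-}` are isomorphisms. -/
structure IsPreHopf : Prop where
  left (X : A) : IsIso (leftFusion B (𝟙_ A) X)
  right (X : A) : IsIso (rightFusion B (𝟙_ A) X)

/-- The comultiplication `B 𝟙 ≅ B (𝟙 ⊗ 𝟙) ⟶ B 𝟙 ⊗ B 𝟙`. -/
def unitComul : B.obj (𝟙_ A) ⟶ B.obj (𝟙_ A) ⊗ B.obj (𝟙_ A) :=
  B.map (λ_ (𝟙_ A)).inv ≫ δ B.toFunctor (𝟙_ A) (𝟙_ A)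

theorem unitComul_assoc : unitComul B ≫ B.obj (𝟙_ A) ◁ unitComul B =
    unitComul B ≫ unitComul B ▷ B.obj (𝟙_ A) ≫ (α_ _ _ _).hom := by
  simp only [unitComul, whiskerLeft_comp, comp_whiskerRight, Category.assoc]
  rw [δ_natural_right_assoc, δ_natural_left_assoc, associativity, ← B.map_comp_assoc,
    ← B.map_comp_assoc, ← B.map_comp_assoc, leftUnitor_inv_whiskerRight]
  simp only [Category.assoc, Iso.inv_hom_id, Category.comp_id, leftUnitor_inv_naturality]

theorem unitComul_left : unitComul B ≫ η B.toFunctor ▷ B.obj (𝟙_ A) = (λ_ _).inv := by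
  rw [left_unitality B.toFunctor, unitComul, Category.assoc]

theorem unitComul_right : unitComul B ≫ B.obj (𝟙_ A) ◁ η B.toFunctor = (ρ_ _).inv := by
  rw [right_unitality B.toFunctor, unitComul, Category.assoc, unitors_inv_equal]

/-- The comonad `C = B 𝟙 ⊗ -`, with comultiplication induced by `B_2(𝟙, 𝟙)` and counit induced
by `B_0`. -/
def tensorComonad : Comonad A where
  toFunctor := tensorLeft (B.obj (𝟙_ A))
  ε :=
    { app := fun X => η B.toFunctor ▷ X ≫ (λ_ X).hom
      naturality := fun X Y f => by
        dsimp
        rw [whisker_exchange_assoc, Category.assoc, leftUnitor_naturality] }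
  δ :=
    { app := fun X => unitComul B ▷ X ≫ (α_ _ _ _).hom
      naturality := fun X Y f => by
        dsimp
        rw [whisker_exchange_assoc]
        simp }
  coassoc X := by
    have h := congrArg (· ▷ X) (unitComul_assoc B)
    dsimp at h ⊢
    simp only [comp_whiskerRight, Category.assoc, whiskerLeft_comp] at h ⊢
    rw [← associator_naturality_middle_assoc, reassoc_of% h]
    simp
  left_counit X := by
    have h := congrArg (· ▷ X) (unitComul_left B)
    dsimp at h ⊢
    simp only [comp_whiskerRight, Category.assoc] at h ⊢
    rw [← associator_naturality_left_assoc, reassoc_of% h, leftUnitor_tensor_hom]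
    simp only [Iso.hom_inv_id_assoc, inv_hom_whiskerRight]
  right_counit X := by
    have h := congrArg (· ▷ X) (unitComul_right B)
    dsimp at h ⊢
    simp only [comp_whiskerRight, Category.assoc, whiskerLeft_comp] at h ⊢
    rw [← associator_naturality_middle_assoc, reassoc_of% h, triangle]
    simp only [inv_hom_whiskerRight]

theorem fusion_naturality {X Y : A} (f : X ⟶ Y) :
    B.map (B.obj (𝟙_ A) ◁ f) ≫ rightFusion B (𝟙_ A) Y =
      rightFusion B (𝟙_ A) X ≫ B.obj (𝟙_ A) ◁ B.map f := by
  rw [rightFusion, rightFusion, ← δ_natural_right_assoc, Category.assoc, whisker_exchange]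

/-- The coaction `B X ≅ B (𝟙 ⊗ X) ⟶ B 𝟙 ⊗ B X` given by `B_2(𝟙, X)`. -/
def freeCoaction (X : A) : B.obj X ⟶ B.obj (𝟙_ A) ⊗ B.obj X :=
  B.map (λ_ X).inv ≫ δ B.toFunctor (𝟙_ A) X

theorem freeCoaction_naturality {X Y : A} (f : X ⟶ Y) :
    freeCoaction B X ≫ B.obj (𝟙_ A) ◁ B.map f = B.map f ≫ freeCoaction B Y := by
  rw [freeCoaction, freeCoaction, Category.assoc, δ_natural_right, ← B.map_comp_assoc,
    ← B.map_comp_assoc, leftUnitor_inv_naturality]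

theorem freeCoaction_counit (X : A) :
    freeCoaction B X ≫ η B.toFunctor ▷ B.obj X ≫ (λ_ (B.obj X)).hom = 𝟙 (B.obj X) := by
  rw [freeCoaction, Category.assoc, left_unitality_hom, ← B.map_comp, Iso.inv_hom_id, B.map_id]

theorem freeCoaction_coassoc (X : A) :
    freeCoaction B X ≫ unitComul B ▷ B.obj X ≫ (α_ _ _ _).hom =
      freeCoaction B X ≫ B.obj (𝟙_ A) ◁ freeCoaction B X := by
  simp only [freeCoaction, unitComul, whiskerLeft_comp, comp_whiskerRight, Category.assoc]
  rw [δ_natural_right_assoc, δ_natural_left_assoc, associativity, ← B.map_comp_assoc,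
    ← B.map_comp_assoc, ← B.map_comp_assoc]
  simp

variable [IsOpmonoidal B]

theorem mul_unitComul : B.μ.app (𝟙_ A) ≫ unitComul B =
    B.map (unitComul B) ≫ δ B.toFunctor (B.obj (𝟙_ A)) (B.obj (𝟙_ A)) ≫
      (B.μ.app (𝟙_ A) ⊗ₘ B.μ.app (𝟙_ A)) := by
  have h : B.map (B.map (λ_ (𝟙_ A)).inv) ≫ B.μ.app (𝟙_ A ⊗ 𝟙_ A) =
    B.μ.app (𝟙_ A) ≫ B.map (λ_ (𝟙_ A)).inv := B.μ.naturality _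
  rw [unitComul, ← reassoc_of% h, IsOpmonoidal.mul_tensor, B.map_comp, Category.assoc]

theorem fusion_mul (X : A) : B.μ.app (B.obj (𝟙_ A) ⊗ X) ≫ rightFusion B (𝟙_ A) X =
    B.map (rightFusion B (𝟙_ A) X) ≫ rightFusion B (𝟙_ A) (B.obj X) ≫
      B.obj (𝟙_ A) ◁ B.μ.app X := by
  simp only [rightFusion, B.map_comp, Category.assoc]
  rw [← Category.assoc, IsOpmonoidal.mul_tensor, ← δ_natural_left_assoc]
  simp only [Category.assoc, tensorHom_def', ← comp_whiskerRight_assoc, ← comp_whiskerRight,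
    B.assoc]
  rw [whisker_exchange]
  rfl

theorem fusion_unit (X : A) : B.η.app (B.obj (𝟙_ A) ⊗ X) ≫ rightFusion B (𝟙_ A) X =
    B.obj (𝟙_ A) ◁ B.η.app X := by
  rw [rightFusion, ← Category.assoc, IsOpmonoidal.unit_tensor, tensorHom_def', Category.assoc,
    ← comp_whiskerRight, B.left_unit]
  simp

theorem fusion_comul (X : A) :
    rightFusion B (𝟙_ A) X ≫ unitComul B ▷ B.obj X ≫ (α_ _ _ _).hom =
      B.map (unitComul B ▷ X ≫ (α_ _ _ _).hom) ≫ rightFusion B (𝟙_ A) (B.obj (𝟙_ A) ⊗ X) ≫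
        B.obj (𝟙_ A) ◁ rightFusion B (𝟙_ A) X := by
  simp only [rightFusion, Category.assoc, B.map_comp, whiskerLeft_comp]
  rw [← comp_whiskerRight_assoc, mul_unitComul, ← whisker_exchange_assoc]
  refine Eq.trans ?_ (congrArg (B.map (unitComul B ▷ X) ≫ ·)
    (associativity_assoc B.toFunctor (B.obj (𝟙_ A)) (B.obj (𝟙_ A)) X
      (B.μ.app (𝟙_ A) ▷ (B.obj (B.obj (𝟙_ A)) ⊗ B.obj X) ≫
        B.obj (𝟙_ A) ◁ B.μ.app (𝟙_ A) ▷ B.obj X)))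
  simp only [MonoidalCategory.tensorHom_def, comp_whiskerRight, Category.assoc]
  rw [δ_natural_left_assoc]
  simp

theorem fusion_counit (X : A) :
    rightFusion B (𝟙_ A) X ≫ η B.toFunctor ▷ B.obj X ≫ (λ_ (B.obj X)).hom =
      B.map (η B.toFunctor ▷ X ≫ (λ_ X).hom) := by
  rw [rightFusion, Category.assoc, ← comp_whiskerRight_assoc, IsOpmonoidal.mul_unit,
    comp_whiskerRight, Category.assoc, δ_natural_left_assoc, left_unitality_hom, ← B.map_comp]

/-- The mixed distributive law
`θ_X = (μ_𝟙 ⊗ B X) ∘ B_2(B 𝟙, X) = H^r_{𝟙,X} : B (B 𝟙 ⊗ X) ⟶ B 𝟙 ⊗ B X`. -/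
def fusionLaw : MixedDistributiveLaw B (tensorComonad B) where
  hom :=
    { app := fun X => rightFusion B (𝟙_ A) X
      naturality := fun _ _ f => fusion_naturality B f }
  mul X := fusion_mul B X
  unit X := fusion_unit B X
  comul X := fusion_comul B X
  counit X := fusion_counit B X

theorem freeCoaction_hom (X : A) :
    B.map (freeCoaction B X) ≫ rightFusion B (𝟙_ A) (B.obj X) ≫ B.obj (𝟙_ A) ◁ B.μ.app X =
      B.μ.app X ≫ freeCoaction B X := by
  have h : B.map (B.map (λ_ X).inv) ≫ B.μ.app (𝟙_ A ⊗ X) =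
    B.μ.app X ≫ B.map (λ_ X).inv := B.μ.naturality _
  rw [freeCoaction, ← reassoc_of% h, IsOpmonoidal.mul_tensor, B.map_comp, Category.assoc,
    rightFusion, Category.assoc, MonoidalCategory.tensorHom_def]

/-- The functor `K : A ⥤ (A^B)_{C^θ}` with `K X = (F X, B_2(𝟙, X))`. -/
def comparisonK : A ⥤ (liftComonad (fusionLaw B)).Coalgebra where
  obj X :=
    { A := B.free.obj X
      a :=
        { f := freeCoaction B X
          h := freeCoaction_hom B X }
      counit := Monad.Algebra.Hom.ext (freeCoaction_counit B X)
      coassoc := Monad.Algebra.Hom.ext (freeCoaction_coassoc B X) }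
  map f :=
    { f := B.free.map f
      h := Monad.Algebra.Hom.ext (freeCoaction_naturality B f) }
  map_id X := Comonad.Coalgebra.Hom.ext (B.free.map_id X)
  map_comp f g := Comonad.Coalgebra.Hom.ext (B.free.map_comp f g)

theorem comparisonK_forget : comparisonK B ⋙ (liftComonad (fusionLaw B)).forget = B.free := rfl

/-- The transformation `N F ⇒ N F (K' T^θ K)` associated with `l : N C^θ ⇒ N T`. -/
def conjugateOpcoalgebra {Z : Type u₃} [Category.{v₃} Z] (N : B.Algebra ⥤ Z)
    {K' : (liftComonad (fusionLaw B)).Coalgebra ⥤ A} (adj : K' ⊣ comparisonK B)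
    (l : (liftComonad (fusionLaw B)).toFunctor ⋙ N ⟶ (freeComonad B).toFunctor ⋙ N) :
    B.free ⋙ N ⟶
      (conjugateComonad adj (extensionComonad (fusionLaw B))).toFunctor ⋙ B.free ⋙ N :=
  conjugateNabla adj (extensionComonad (fusionLaw B)) ((liftComonad (fusionLaw B)).forget ⋙ N)
    (nabla (fusionLaw B) N l)

end Opmonoidal

end HopfMonads

/-! The statement splits into an equivalence of categories and two independent changes of variables.

For the equivalence, `B_2(𝟙, -)` makes the left adjoint `F` a `C^θ`-comodule, and such a coaction is
the same thing as a comonad morphism `κ : T ⟶ C^θ`, with `κ_(Y,α) = (B 𝟙 ⊗ α) ∘ B_2(𝟙, Y)`. On a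
free algebra this is the left fusion operator up to a unitor, hence invertible. Every algebra is a
split quotient of a free one in the base category, so `κ` is invertible everywhere
(`isIso_coaction_action`). Coalgebras over `T` and over `C^θ` then agree, and `K` is the comparison
functor of `F ⊣ U` followed by this identification; comonadicity of `F` finishes
(`comparisonK_isEquivalence`).

For the bijection, write `N C^θ = N V R` with `R` the cofree coalgebra functor. The adjunction `V ⊣
R` turns transformations `N V R ⇒ N T` into transformations `N V ⇒ N T V = N V T^θ`
(`nabla_bijective`), and left `χ`-coalgebras become exactly the `T^θ`-opcoalgebras on `N V`
(`isOpcoalgebra_nabla_iff`). Opcoalgebras are then transported along the equivalence `K`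
(`conjugateNabla_bijective`, `isOpcoalgebra_conjugateNabla_iff`), where `V K = F`. -/

namespace HopfMonads

/-! ### Transport of opcoalgebra structures along an equivalence -/

section Conjugation

variable {A : Type u₁} [Category.{v₁} A] {E : Type u₂} [Category.{v₂} E]
  {Z : Type u₃} [Category.{v₃} Z] {K' : E ⥤ A} {K : A ⥤ E} (adj : K' ⊣ K) (Q : Comonad E)
  (M : E ⥤ Z)

theorem conjugateNabla_app (n : M ⟶ Q.toFunctor ⋙ M) (X : A) :
    (conjugateNabla adj Q M n).app X =
      n.app (K.obj X) ≫ M.map (adj.unit.app (Q.obj (K.obj X))) := rfl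

theorem opcoalgebra_naturality {M : E ⥤ Z} {Q : Comonad E} (n : M ⟶ Q.toFunctor ⋙ M) {X Y : E}
    (f : X ⟶ Y) : M.map f ≫ n.app Y = n.app X ≫ M.map (Q.map f) := n.naturality f

theorem map_unit_naturality {X Y : E} (f : X ⟶ Y) :
    M.map (adj.unit.app X) ≫ M.map (K.map (K'.map f)) = M.map f ≫ M.map (adj.unit.app Y) := by
  rw [← M.map_comp, ← M.map_comp]
  exact congrArg M.map (adj.unit.naturality f).symm

/-- The component at `X` of a transformation `M K ⇒ M K (K' Q K)`. -/
def conjugateComponent {Q : Comonad E} {M : E ⥤ Z}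
    (γ : K ⋙ M ⟶ (conjugateComonad adj Q).toFunctor ⋙ K ⋙ M) (X : A) :
    M.obj (K.obj X) ⟶ M.obj (K.obj (K'.obj (Q.obj (K.obj X)))) := γ.app X

theorem conjugateComponent_naturality {Q : Comonad E} {M : E ⥤ Z}
    (γ : K ⋙ M ⟶ (conjugateComonad adj Q).toFunctor ⋙ K ⋙ M) {X Y : A} (f : X ⟶ Y) :
    M.map (K.map f) ≫ conjugateComponent adj γ Y =
      conjugateComponent adj γ X ≫ M.map (K.map (K'.map (Q.map (K.map f)))) := γ.naturality f

/-- An inverse of `conjugateNabla` for an equivalence `K` with quasi-inverse `K'`. -/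
noncomputable def conjugateNablaInv [IsIso adj.unit]
    (γ : K ⋙ M ⟶ (conjugateComonad adj Q).toFunctor ⋙ K ⋙ M) :
    M ⟶ Q.toFunctor ⋙ M where
  app Y := M.map (adj.unit.app Y) ≫ conjugateComponent adj γ (K'.obj Y) ≫
    M.map (inv (adj.unit.app (Q.obj (K.obj (K'.obj Y))))) ≫ M.map (Q.map (inv (adj.unit.app Y)))
  naturality X Y f := by
    have h1 := map_unit_naturality adj M f
    have h2 := conjugateComponent_naturality adj γ (K'.map f)
    have h3 := map_unit_naturality adj M (Q.map (K.map (K'.map f)))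
    have h4 : K.map (K'.map f) ≫ inv (adj.unit.app Y) = inv (adj.unit.app X) ≫ f := by
      rw [IsIso.comp_inv_eq, Category.assoc, IsIso.eq_inv_comp]
      exact (adj.unit.naturality f).symm
    have h5 : M.map (Q.map (K.map (K'.map f))) ≫ M.map (Q.map (inv (adj.unit.app Y))) =
        M.map (Q.map (inv (adj.unit.app X))) ≫ M.map (Q.map f) := by
      rw [← M.map_comp, ← M.map_comp, ← Q.map_comp, ← Q.map_comp, h4]
    have h6 : M.map (K.map (K'.map (Q.map (K.map (K'.map f))))) ≫
          M.map (inv (adj.unit.app (Q.obj (K.obj (K'.obj Y))))) =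
        M.map (inv (adj.unit.app (Q.obj (K.obj (K'.obj X))))) ≫
          M.map (Q.map (K.map (K'.map f))) := by
      rw [Functor.map_inv, Functor.map_inv, IsIso.comp_inv_eq, Category.assoc, IsIso.eq_inv_comp]
      exact h3
    change M.map f ≫ _ = _ ≫ M.map (Q.map f)
    dsimp only [Functor.id_obj, Functor.comp_obj] at h1 h2 h5 h6 ⊢
    rw [← reassoc_of% h1, reassoc_of% h2]
    simp only [Category.assoc]
    rw [reassoc_of% h6, h5]

/-- The conjugate axioms at `X` are the original axioms at `K X`, up to cancelling components of the
unit, which is invertible because `K` is an equivalence. Axioms on the image of `K` suffice, since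
each `Y` is isomorphic to `K K' Y` through the unit. -/
theorem isOpcoalgebra_conjugateNabla_iff [K.IsEquivalence] (n : M ⟶ Q.toFunctor ⋙ M) :
    IsOpcoalgebra (conjugateComonad adj Q) (K ⋙ M) (conjugateNabla adj Q M n) ↔
      IsOpcoalgebra Q M n := by
  have coassoc_iff (X : A) :
      (conjugateNabla adj Q M n).app X ≫ (K ⋙ M).map ((conjugateComonad adj Q).δ.app X) =
        (conjugateNabla adj Q M n).app X ≫
          (conjugateNabla adj Q M n).app ((conjugateComonad adj Q).obj X) ↔
      n.app (K.obj X) ≫ M.map (Q.δ.app (K.obj X)) =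
        n.app (K.obj X) ≫ n.app (Q.obj (K.obj X)) := by
    have h1 := map_unit_naturality adj M (Q.δ.app (K.obj X))
    have h2 := map_unit_naturality adj M (Q.map (adj.unit.app (Q.obj (K.obj X))))
    have h3 := opcoalgebra_naturality n (adj.unit.app (Q.obj (K.obj X)))
    change (n.app (K.obj X) ≫ M.map (adj.unit.app (Q.obj (K.obj X)))) ≫
        M.map (K.map (K'.map (Q.δ.app (K.obj X)) ≫
          K'.map (Q.map (adj.unit.app (Q.obj (K.obj X)))))) =
      (n.app (K.obj X) ≫ M.map (adj.unit.app (Q.obj (K.obj X)))) ≫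
        n.app (K.obj (K'.obj (Q.obj (K.obj X)))) ≫
          M.map (adj.unit.app (Q.obj (K.obj (K'.obj (Q.obj (K.obj X)))))) ↔ _
    dsimp only [Functor.id_obj, Functor.comp_obj] at h1 h2 h3 ⊢
    simp only [Category.assoc, K.map_comp, M.map_comp]
    rw [reassoc_of% h1, h2, reassoc_of% h3]
    -- Naturality has pushed the unit to the right, so both sides now end in the same two
    -- isomorphisms, the images of `Q` of the unit and of the unit.
    simp only [← Category.assoc, cancel_mono]
  have counit_iff (X : A) :
      (conjugateNabla adj Q M n).app X ≫ (K ⋙ M).map ((conjugateComonad adj Q).ε.app X) =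
        𝟙 ((K ⋙ M).obj X) ↔
      n.app (K.obj X) ≫ M.map (Q.ε.app (K.obj X)) = 𝟙 (M.obj (K.obj X)) := by
    have h1 := map_unit_naturality adj M (Q.ε.app (K.obj X))
    have h2 : M.map (adj.unit.app (K.obj X)) ≫ M.map (K.map (adj.counit.app X)) =
        𝟙 (M.obj (K.obj X)) := by
      rw [← M.map_comp]
      exact (congrArg M.map (adj.right_triangle_components X)).trans (M.map_id _)
    change (n.app (K.obj X) ≫ M.map (adj.unit.app (Q.obj (K.obj X)))) ≫
        M.map (K.map (K'.map (Q.ε.app (K.obj X)) ≫ adj.counit.app X)) = 𝟙 (M.obj (K.obj X)) ↔ _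
    dsimp only [Functor.id_obj, Functor.comp_obj] at h1 h2 ⊢
    simp only [Category.assoc, K.map_comp, M.map_comp]
    rw [reassoc_of% h1, h2, Category.comp_id]
  constructor
  · intro h
    constructor
    · intro Y
      have h1 := (coassoc_iff (K'.obj Y)).1 (h.coassoc _)
      have h2 := opcoalgebra_naturality n (adj.unit.app Y)
      have h3 := opcoalgebra_naturality n (Q.map (adj.unit.app Y))
      have h4 : M.map (Q.δ.app Y) ≫ M.map (Q.map (Q.map (adj.unit.app Y))) =
          M.map (Q.map (adj.unit.app Y)) ≫ M.map (Q.δ.app _) := by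
        rw [← M.map_comp, ← M.map_comp]
        exact congrArg M.map (Q.δ.naturality _).symm
      dsimp only [Functor.id_obj, Functor.comp_obj] at h1 h2 h3 h4
      -- Composing with this isomorphism moves the identity at `Y` to the one already known at `K K'
      -- Y`.
      rw [← cancel_mono (M.map (Q.map (Q.map (adj.unit.app Y))))]
      dsimp only [Functor.id_obj, Functor.comp_obj]
      rw [Category.assoc, Category.assoc, h4, ← h3, ← reassoc_of% h2, ← reassoc_of% h2, h1]
    · intro Y
      have h1 := (counit_iff (K'.obj Y)).1 (h.counit _)
      have h2 := opcoalgebra_naturality n (adj.unit.app Y)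
      have h4 : M.map (Q.ε.app Y) ≫ M.map (adj.unit.app Y) =
          M.map (Q.map (adj.unit.app Y)) ≫ M.map (Q.ε.app _) := by
        rw [← M.map_comp, ← M.map_comp]
        exact congrArg M.map (Q.ε.naturality _).symm
      dsimp only [Functor.id_obj, Functor.comp_obj] at h1 h2 h4
      rw [← cancel_mono (M.map (adj.unit.app Y))]
      dsimp only [Functor.id_obj, Functor.comp_obj]
      rw [Category.assoc, h4, ← reassoc_of% h2, h1, Category.comp_id, Category.id_comp]
  · intro h
    exact ⟨fun X => (coassoc_iff X).2 (h.coassoc _), fun X => (counit_iff X).2 (h.counit _)⟩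

/-- A transformation out of `M` is determined by its components on the image of `K`, by naturality
along the unit `Y ⟶ K K' Y`; conversely such components extend to all of `E` by conjugating with the
unit. -/
theorem conjugateNabla_bijective [K.IsEquivalence] : Function.Bijective (conjugateNabla adj Q M) := by
  constructor
  · intro n n' h
    ext Y
    have h1 := NatTrans.congr_app h (K'.obj Y)
    rw [conjugateNabla_app, conjugateNabla_app] at h1
    have h2 := (cancel_mono _).1 h1
    have h3 := opcoalgebra_naturality n (adj.unit.app Y)
    have h4 := opcoalgebra_naturality n' (adj.unit.app Y)
    dsimp only [Functor.id_obj, Functor.comp_obj] at h2 h3 h4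
    rw [h2, h4] at h3
    exact ((cancel_mono _).1 h3).symm
  · intro γ
    refine ⟨conjugateNablaInv adj Q M γ, ?_⟩
    ext X
    have h1 := conjugateComponent_naturality adj γ (adj.counit.app X)
    have h2 := map_unit_naturality adj M (Q.map (K.map (adj.counit.app X)))
    -- By the triangle identity the inverse unit at `K X` comes from a morphism `K' K X ⟶ X` of `A`,
    -- along which `γ` is natural.
    have h3 : inv (adj.unit.app (K.obj X)) = K.map (adj.counit.app X) := by
      rw [IsIso.inv_eq_of_hom_inv_id]
      exact adj.right_triangle_components X
    have h4 : M.map (adj.unit.app (K.obj X)) ≫ M.map (K.map (adj.counit.app X)) =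
        𝟙 (M.obj (K.obj X)) := by
      rw [← M.map_comp]
      exact (congrArg M.map (adj.right_triangle_components X)).trans (M.map_id _)
    change (M.map (adj.unit.app (K.obj X)) ≫ conjugateComponent adj γ (K'.obj (K.obj X)) ≫
      M.map (inv (adj.unit.app (Q.obj (K.obj (K'.obj (K.obj X)))))) ≫
        M.map (Q.map (inv (adj.unit.app (K.obj X))))) ≫
          M.map (adj.unit.app (Q.obj (K.obj X))) = conjugateComponent adj γ X
    dsimp only [Functor.id_obj, Functor.comp_obj] at h1 h2 h3 h4 ⊢
    rw [h3]
    simp only [Category.assoc]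
    rw [← h2, Functor.map_inv, IsIso.inv_hom_id_assoc, ← h1, reassoc_of% h4]

end Conjugation

/-! ### The forgetful-cofree adjunction and left `χ`-coalgebras -/

section Nabla

variable {A : Type u₁} [Category.{v₁} A] {B : Monad A} {C : Comonad A}
  (θ : MixedDistributiveLaw B C) {Z : Type u₂} [Category.{v₂} Z] (N : B.Algebra ⥤ Z)

/-- The inverse of `nabla`: it sends `∇` to `N T ε ∘ ∇ R`, with `R` the cofree coalgebra
functor. -/
def nablaInv (n : (liftComonad θ).forget ⋙ N ⟶
      (extensionComonad θ).toFunctor ⋙ (liftComonad θ).forget ⋙ N) :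
    (liftComonad θ).toFunctor ⋙ N ⟶ (freeComonad B).toFunctor ⋙ N where
  app X := n.app ((liftComonad θ).cofree.obj X) ≫
    N.map ((freeComonad B).map ((liftComonad θ).ε.app X))
  naturality X Y f := by
    have h : N.map ((liftComonad θ).map f) ≫ n.app ((liftComonad θ).cofree.obj Y) =
      n.app ((liftComonad θ).cofree.obj X) ≫
        N.map ((freeComonad B).map ((liftComonad θ).map f)) :=
      n.naturality ((liftComonad θ).cofree.map f)
    have h2 : (liftComonad θ).map f ≫ (liftComonad θ).ε.app Y = (liftComonad θ).ε.app X ≫ f :=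
      (liftComonad θ).ε.naturality f
    have h3 : N.map ((freeComonad B).map ((liftComonad θ).map f)) ≫
          N.map ((freeComonad B).map ((liftComonad θ).ε.app Y)) =
        N.map ((freeComonad B).map ((liftComonad θ).ε.app X)) ≫ N.map ((freeComonad B).map f) := by
      rw [← N.map_comp, ← N.map_comp, ← Functor.map_comp, ← Functor.map_comp, h2]
    change N.map ((liftComonad θ).map f) ≫ n.app ((liftComonad θ).cofree.obj Y) ≫ _ =
      (n.app ((liftComonad θ).cofree.obj X) ≫ _) ≫ N.map ((freeComonad B).map f)
    refine ((Category.assoc _ _ _).symm.trans (congrArg (· ≫ _) h)).trans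
      ((Category.assoc _ _ _).trans (Eq.trans ?_ (Category.assoc _ _ _).symm))
    exact congrArg (n.app ((liftComonad θ).cofree.obj X) ≫ ·) h3

/-- This is the mate correspondence for the forgetful-cofree adjunction: one composite reduces to
the counit law of the comonad `C^θ`, the other to the counit law of a coalgebra. -/
theorem nabla_bijective : Function.Bijective (nabla θ N) := by
  refine Function.bijective_iff_has_inverse.2 ⟨nablaInv θ N, fun l => ?_, fun n => ?_⟩
  · ext X
    have h : N.map ((liftComonad θ).map ((liftComonad θ).ε.app X)) ≫ l.app X =
      l.app ((liftComonad θ).obj X) ≫ N.map ((freeComonad B).map ((liftComonad θ).ε.app X)) :=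
        l.naturality ((liftComonad θ).ε.app X)
    have h2 : N.map ((liftComonad θ).δ.app X) ≫
        N.map ((liftComonad θ).map ((liftComonad θ).ε.app X)) =
          𝟙 (N.obj ((liftComonad θ).obj X)) := by
      rw [← N.map_comp, Comonad.right_counit]
      exact N.map_id _
    change (N.map ((liftComonad θ).δ.app X) ≫ l.app ((liftComonad θ).obj X)) ≫
      N.map ((freeComonad B).map ((liftComonad θ).ε.app X)) = l.app X
    rw [Category.assoc, ← h, reassoc_of% h2]
  · ext Y
    have h : N.map Y.a ≫ n.app ((liftComonad θ).cofree.obj Y.A) =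
        n.app Y ≫ N.map ((freeComonad B).map Y.a) :=
      -- Coassociativity says that the structure map of `Y` is itself a coalgebra morphism from `Y`
      -- to the cofree coalgebra on `Y.A`; it is the unit of the adjunction.
      n.naturality (X := Y) (Y := (liftComonad θ).cofree.obj Y.A) ⟨Y.a, Y.coassoc.symm⟩
    have h2 : N.map ((freeComonad B).map Y.a) ≫
        N.map ((freeComonad B).map ((liftComonad θ).ε.app Y.A)) = 𝟙 _ := by
      rw [← N.map_comp, ← Functor.map_comp, Y.counit]
      exact (congrArg N.map ((freeComonad B).map_id _)).trans (N.map_id _)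
    change N.map Y.a ≫ n.app ((liftComonad θ).cofree.obj Y.A) ≫
      N.map ((freeComonad B).map ((liftComonad θ).ε.app Y.A)) = n.app Y
    refine ((Category.assoc _ _ _).symm.trans (congrArg (· ≫ _) h)).trans
      ((Category.assoc _ _ _).trans (Eq.trans ?_ (Category.comp_id _)))
    exact congrArg (n.app Y ≫ ·) h2

/-- The coaction on `T^θ Y` contains `χ`, so the opcoalgebra law at `Y` is the left coalgebra law at
`Y.A` precomposed with the structure map of `Y`. The law on algebras is recovered from cofree
coalgebras by applying the counit of `C^θ`. -/
theorem isOpcoalgebra_nabla_iff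
    (l : (liftComonad θ).toFunctor ⋙ N ⟶ (freeComonad B).toFunctor ⋙ N) :
    IsOpcoalgebra (extensionComonad θ) ((liftComonad θ).forget ⋙ N) (nabla θ N l) ↔
      IsLeftCoalgebra (chi θ) N l := by
  have hl {X Y : B.Algebra} (f : X ⟶ Y) : N.map ((liftComonad θ).map f) ≫ l.app Y =
    l.app X ≫ N.map ((freeComonad B).map f) := l.naturality f
  constructor
  · intro h
    constructor
    · intro X
      have h1 := h.coassoc ((liftComonad θ).cofree.obj X)
      change (N.map ((liftComonad θ).δ.app X) ≫ l.app ((liftComonad θ).obj X)) ≫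
          N.map ((freeComonad B).δ.app ((liftComonad θ).obj X)) =
        (N.map ((liftComonad θ).δ.app X) ≫ l.app ((liftComonad θ).obj X)) ≫
          N.map ((freeComonad B).map ((liftComonad θ).δ.app X) ≫
            (chi θ).app ((liftComonad θ).obj X)) ≫
            l.app ((freeComonad B).obj ((liftComonad θ).obj X)) at h1
      -- On the cofree coalgebra the law carries one surplus `C^θ`; its counit, moved leftwards by
      -- naturality, meets the comultiplication and cancels by the counit law.
      have h2 := congrArg
        (· ≫ N.map ((freeComonad B).map ((freeComonad B).map ((liftComonad θ).ε.app X)))) h1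
      have e1 : N.map ((freeComonad B).δ.app ((liftComonad θ).obj X)) ≫
          N.map ((freeComonad B).map ((freeComonad B).map ((liftComonad θ).ε.app X))) =
          N.map ((freeComonad B).map ((liftComonad θ).ε.app X)) ≫
            N.map ((freeComonad B).δ.app X) := by
        rw [← N.map_comp, ← N.map_comp]
        exact congrArg N.map ((freeComonad B).δ.naturality _).symm
      have e2 : N.map ((liftComonad θ).δ.app X) ≫
          N.map ((liftComonad θ).map ((liftComonad θ).ε.app X)) =
            𝟙 (N.obj ((liftComonad θ).obj X)) := by
        rw [← N.map_comp, Comonad.right_counit]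
        exact N.map_id _
      have e3 : N.map ((chi θ).app ((liftComonad θ).obj X)) ≫
          N.map ((liftComonad θ).map ((freeComonad B).map ((liftComonad θ).ε.app X))) =
          N.map ((freeComonad B).map ((liftComonad θ).map ((liftComonad θ).ε.app X))) ≫
            N.map ((chi θ).app X) := by
        rw [← N.map_comp, ← N.map_comp]
        exact congrArg N.map ((chi θ).naturality _).symm
      have e4 : N.map ((freeComonad B).map ((liftComonad θ).δ.app X)) ≫
          N.map ((freeComonad B).map ((liftComonad θ).map ((liftComonad θ).ε.app X))) =
            𝟙 _ := by
        rw [← N.map_comp, ← Functor.map_comp, Comonad.right_counit]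
        exact (congrArg N.map ((freeComonad B).map_id _)).trans (N.map_id _)
      have e5 := hl ((freeComonad B).map ((liftComonad θ).ε.app X))
      simp only [Category.assoc, N.map_comp] at h2
      rw [e1, ← e5, reassoc_of% e3, reassoc_of% e4, ← reassoc_of% (hl ((liftComonad θ).ε.app X)),
        reassoc_of% e2] at h2
      exact h2
    · intro X
      have h1 := h.counit ((liftComonad θ).cofree.obj X)
      change (N.map ((liftComonad θ).δ.app X) ≫ l.app ((liftComonad θ).obj X)) ≫
          N.map ((freeComonad B).ε.app ((liftComonad θ).obj X)) = 𝟙 _ at h1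
      have h2 := congrArg (· ≫ N.map ((liftComonad θ).ε.app X)) h1
      have e1 : N.map ((freeComonad B).ε.app ((liftComonad θ).obj X)) ≫
          N.map ((liftComonad θ).ε.app X) =
          N.map ((freeComonad B).map ((liftComonad θ).ε.app X)) ≫
            N.map ((freeComonad B).ε.app X) := by
        rw [← N.map_comp, ← N.map_comp]
        exact congrArg N.map ((freeComonad B).ε.naturality _).symm
      have e2 : N.map ((liftComonad θ).δ.app X) ≫
          N.map ((liftComonad θ).map ((liftComonad θ).ε.app X)) =
            𝟙 (N.obj ((liftComonad θ).obj X)) := by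
        rw [← N.map_comp, Comonad.right_counit]
        exact N.map_id _
      simp only [Category.assoc] at h2
      rw [e1, ← reassoc_of% (hl ((liftComonad θ).ε.app X)), reassoc_of% e2] at h2
      exact h2.trans (Category.id_comp _)
  · intro h
    constructor
    · intro Y
      change (N.map Y.a ≫ l.app Y.A) ≫ N.map ((freeComonad B).δ.app Y.A) =
        (N.map Y.a ≫ l.app Y.A) ≫ N.map ((freeComonad B).map Y.a ≫ (chi θ).app Y.A) ≫
          l.app ((freeComonad B).obj Y.A)
      -- Coassociativity of `Y` replaces the comultiplication of `C^θ` by a second structure map,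
      -- which naturality of `l` carries past `l`.
      rw [Category.assoc, h.comul, N.map_comp, Category.assoc, Category.assoc,
        ← reassoc_of% (hl Y.a), ← N.map_comp_assoc, ← N.map_comp_assoc, Y.coassoc]
    · intro Y
      change (N.map Y.a ≫ l.app Y.A) ≫ N.map ((freeComonad B).ε.app Y.A) = 𝟙 (N.obj Y.A)
      rw [Category.assoc, h.counit, ← N.map_comp, Y.counit, N.map_id]

end Nabla

/-! ### Coalgebras over isomorphic comonads -/

section ComonadIso

variable {D : Type u₁} [Category.{v₁} D] {T S : Comonad D}

/-- The functor on coalgebras induced by a comonad morphism `κ : T ⟶ S`. -/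
def coalgebraFunctor (κ : T ⟶ S) : T.Coalgebra ⥤ S.Coalgebra where
  obj Y :=
    { A := Y.A
      a := Y.a ≫ κ.app Y.A
      counit := by
        rw [Category.assoc, ComonadHom.app_ε, Y.counit]
      coassoc := by
        rw [Category.assoc, ComonadHom.app_δ, Y.coassoc_assoc, S.map_comp, κ.naturality_assoc,
          Category.assoc] }
  map {Y Y'} f :=
    { f := f.f
      h := by
        change (Y.a ≫ κ.app Y.A) ≫ S.map f.f = f.f ≫ Y'.a ≫ κ.app Y'.A
        rw [Category.assoc, ← κ.naturality, f.h_assoc] }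
  map_id _ := rfl
  map_comp _ _ := rfl

theorem isEquivalence_coalgebraFunctor (κ : T ⟶ S) [∀ X, IsIso (κ.app X)] :
    (coalgebraFunctor κ).IsEquivalence where
  faithful := ⟨fun {_ _} _ _ h => by
    injection h with h
    exact Comonad.Coalgebra.Hom.ext h⟩
  full := ⟨fun {Y Y'} f => by
    have key (g : Y.A ⟶ Y'.A) (h : (Y.a ≫ κ.app Y.A) ≫ S.map g = g ≫ Y'.a ≫ κ.app Y'.A) :
        Y.a ≫ T.map g = g ≫ Y'.a := by
      rw [Category.assoc, ← κ.naturality] at h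
      rw [← cancel_mono (κ.app Y'.A), Category.assoc, Category.assoc, h]
    exact ⟨⟨f.f, key f.f f.h⟩, rfl⟩⟩
  essSurj := ⟨fun Y => ⟨
    { A := Y.A
      a := Y.a ≫ inv (κ.app Y.A)
      counit := by
        rw [Category.assoc, ← ComonadHom.app_ε κ, IsIso.inv_hom_id_assoc, Y.counit]
      coassoc := by
        have h : T.δ.app Y.A ≫ T.map (κ.app Y.A) ≫ κ.app (S.obj Y.A) =
          κ.app Y.A ≫ S.δ.app Y.A := by
          rw [ComonadHom.app_δ, κ.naturality]
        -- The horizontal square of `κ` is invertible, and after composing with it coassociativity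
        -- over `T` becomes coassociativity over `S`.
        rw [← cancel_mono (T.map (κ.app Y.A) ≫ κ.app (S.obj Y.A))]
        simp only [Category.assoc]
        rw [h, IsIso.inv_hom_id_assoc, Y.coassoc, ← T.map_comp_assoc, Category.assoc,
          IsIso.inv_hom_id, Category.comp_id, κ.naturality, IsIso.inv_hom_id_assoc] },
    ⟨Comonad.Coalgebra.isoMk (Iso.refl Y.A) (by
      change ((Y.a ≫ inv (κ.app Y.A)) ≫ κ.app Y.A) ≫ S.map (𝟙 _) = 𝟙 _ ≫ Y.a
      simp)⟩⟩⟩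

end ComonadIso

/-! ### Coactions on a left adjoint as comonad morphisms -/

section CoalgebraLift

variable {A : Type u₁} [Category.{v₁} A] {D : Type u₂} [Category.{v₂} D]
  {F : A ⥤ D} {U : D ⥤ A} (adj : F ⊣ U) {S : Comonad D} (b : F ⟶ F ⋙ S.toFunctor)
  (counit : ∀ X, b.app X ≫ S.ε.app (F.obj X) = 𝟙 (F.obj X))
  (coassoc : ∀ X, b.app X ≫ S.δ.app (F.obj X) = b.app X ≫ S.map (b.app X))

/-- The comonad morphism `F U ⟶ S` induced by a coaction `F ⟶ S F` of `S` on a left adjoint `F`. -/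
def comonadHomOfCoaction : adj.toComonad ⟶ S where
  app Y := b.app (U.obj Y) ≫ S.map (adj.counit.app Y)
  naturality Y Y' f := by
    have h : F.map (U.map f) ≫ b.app (U.obj Y') = b.app (U.obj Y) ≫ S.map (F.map (U.map f)) :=
      b.naturality (U.map f)
    change F.map (U.map f) ≫ b.app (U.obj Y') ≫ S.map (adj.counit.app Y') =
      (b.app (U.obj Y) ≫ S.map (adj.counit.app Y)) ≫ S.map f
    rw [reassoc_of% h, Category.assoc, ← S.map_comp, ← S.map_comp]
    exact congrArg (fun g => b.app (U.obj Y) ≫ S.map g) (adj.counit.naturality f)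
  app_ε Y := by
    have h : S.map (adj.counit.app Y) ≫ S.ε.app Y = S.ε.app _ ≫ adj.counit.app Y :=
      S.ε.naturality _
    change (b.app (U.obj Y) ≫ S.map (adj.counit.app Y)) ≫ S.ε.app Y = adj.counit.app Y
    rw [Category.assoc, h, ← Category.assoc]
    exact (congrArg (· ≫ _) (counit _)).trans (Category.id_comp _)
  app_δ Y := by
    have h : S.map (adj.counit.app Y) ≫ S.δ.app Y = S.δ.app _ ≫ S.map (S.map (adj.counit.app Y)) :=
      S.δ.naturality _
    have h2 : F.map (adj.unit.app (U.obj Y)) ≫ b.app (U.obj (F.obj (U.obj Y))) =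
      b.app (U.obj Y) ≫ S.map (F.map (adj.unit.app (U.obj Y))) := b.naturality _
    have h3 := coassoc (U.obj Y)
    change (b.app (U.obj Y) ≫ S.map (adj.counit.app Y)) ≫ S.δ.app Y =
      F.map (adj.unit.app (U.obj Y)) ≫
        (b.app (U.obj (F.obj (U.obj Y))) ≫ S.map (adj.counit.app (F.obj (U.obj Y)))) ≫
          S.map (b.app (U.obj Y) ≫ S.map (adj.counit.app Y))
    -- The unit in the comultiplication of `F U` slides past `b` and cancels with the counit by a
    -- triangle identity, leaving the coassociativity of `b`.
    rw [Category.assoc, Category.assoc, reassoc_of% h2, ← S.map_comp_assoc (F.map _),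
      adj.left_triangle_components, h]
    dsimp only [Functor.comp_obj, Functor.id_obj] at h3 ⊢
    rw [reassoc_of% h3, S.map_comp, S.map_id, Category.id_comp]

end CoalgebraLift

/-! ### The comonads `T` and `C^θ` are isomorphic, and `K` is an equivalence -/

section Opmonoidal

open Functor.OplaxMonoidal

variable {A : Type u₁} [Category.{v₁} A] [MonoidalCategory A]
  (B : Monad A) [B.toFunctor.OplaxMonoidal]

/-- On an algebra `Y`, the canonical map `B Y ⟶ B 𝟙 ⊗ Y` is invertible if this holds on free
algebras, since `Y` is the coequalizer of a split pair of free algebras. -/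
theorem isIso_coaction_action (hB : ∀ X, IsIso (leftFusion B (𝟙_ A) X)) (Y : B.Algebra) :
    IsIso (freeCoaction B Y.A ≫ B.obj (𝟙_ A) ◁ Y.a) := by
  have free_iso (X : A) : IsIso (freeCoaction B (B.obj X) ≫ B.obj (𝟙_ A) ◁ B.μ.app X) := by
    have := hB X
    have h : freeCoaction B (B.obj X) ≫ B.obj (𝟙_ A) ◁ B.μ.app X =
        B.map (λ_ (B.obj X)).inv ≫ leftFusion B (𝟙_ A) X := by
      rw [freeCoaction, leftFusion, Category.assoc]
    rw [h]
    infer_instance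
  -- naturality in morphisms of algebras
  have nat {X X' : B.Algebra} (f : X ⟶ X') :
      B.map f.f ≫ freeCoaction B X'.A ≫ B.obj (𝟙_ A) ◁ X'.a =
        (freeCoaction B X.A ≫ B.obj (𝟙_ A) ◁ X.a) ≫ B.obj (𝟙_ A) ◁ f.f := by
    rw [← reassoc_of% (freeCoaction_naturality B f.f), Category.assoc, ← whiskerLeft_comp,
      ← whiskerLeft_comp, f.h]
  have := free_iso Y.A
  have := free_iso (B.obj Y.A)
  set κ := freeCoaction B Y.A ≫ B.obj (𝟙_ A) ◁ Y.a with hκ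
  set κ₁ := freeCoaction B (B.obj Y.A) ≫ B.obj (𝟙_ A) ◁ B.μ.app Y.A with hκ₁
  set κ₂ := freeCoaction B (B.obj (B.obj Y.A)) ≫ B.obj (𝟙_ A) ◁ B.μ.app (B.obj Y.A) with hκ₂
  have n₁ : B.map Y.a ≫ κ = κ₁ ≫ B.obj (𝟙_ A) ◁ Y.a :=
    nat (X := B.free.obj Y.A) (X' := Y) ⟨Y.a, Y.assoc.symm⟩
  have n₂ : B.map (B.map Y.a) ≫ κ₁ = κ₂ ≫ B.obj (𝟙_ A) ◁ B.map Y.a := nat (B.free.map Y.a)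
  have n₃ : B.map (B.μ.app Y.A) ≫ κ₁ = κ₂ ≫ B.obj (𝟙_ A) ◁ B.μ.app Y.A :=
    nat (X := B.free.obj (B.obj Y.A)) (X' := B.free.obj Y.A) ⟨B.μ.app Y.A, B.assoc Y.A⟩
  have n₂' : B.obj (𝟙_ A) ◁ B.map Y.a ≫ inv κ₁ = inv κ₂ ≫ B.map (B.map Y.a) := by
    rw [IsIso.comp_inv_eq, Category.assoc, n₂, IsIso.inv_hom_id_assoc]
  have n₃' : B.obj (𝟙_ A) ◁ B.μ.app Y.A ≫ inv κ₁ = inv κ₂ ≫ B.map (B.μ.app Y.A) := by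
    rw [IsIso.comp_inv_eq, Category.assoc, n₃, IsIso.inv_hom_id_assoc]
  have ηnat : Y.a ≫ B.η.app Y.A = B.η.app (B.obj Y.A) ≫ B.map Y.a := B.η.naturality Y.a
  have assoc : B.map (B.map Y.a) ≫ B.map Y.a = B.map (B.μ.app Y.A) ≫ B.map Y.a := by
    rw [← B.map_comp, ← B.map_comp, Y.assoc]
  have split : B.map (B.η.app Y.A) ≫ B.map Y.a = 𝟙 (B.obj Y.A) := by
    rw [← B.map_comp, Y.unit]
    exact B.map_id _
  have unit : B.obj (𝟙_ A) ◁ B.η.app Y.A ≫ B.obj (𝟙_ A) ◁ Y.a = 𝟙 (B.obj (𝟙_ A) ⊗ Y.A) := by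
    rw [← whiskerLeft_comp, Y.unit]
    exact whiskerLeft_id _ _
  have unit₁ : B.obj (𝟙_ A) ◁ B.η.app (B.obj Y.A) ≫ B.obj (𝟙_ A) ◁ B.μ.app Y.A =
      𝟙 (B.obj (𝟙_ A) ⊗ B.obj Y.A) := by
    rw [← whiskerLeft_comp, B.left_unit]
    exact whiskerLeft_id _ _
  -- The inverse lifts along the section `η` to the free algebra on `Y.A`, inverts the canonical map
  -- there, and projects back by the action.
  refine ⟨B.obj (𝟙_ A) ◁ B.η.app Y.A ≫ inv κ₁ ≫ B.map Y.a, ?_, ?_⟩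
  · have : IsSplitEpi (B.map Y.a) := ⟨⟨⟨_, split⟩⟩⟩
    rw [← cancel_epi (B.map Y.a), reassoc_of% n₁, ← whiskerLeft_comp_assoc, ηnat,
      whiskerLeft_comp_assoc, reassoc_of% n₂', assoc, ← reassoc_of% n₃', reassoc_of% unit₁,
      IsIso.hom_inv_id_assoc]
    exact (Category.comp_id _).symm
  · rw [Category.assoc, Category.assoc, n₁, IsIso.inv_hom_id_assoc, unit]

variable [IsOpmonoidal B]

/-- The coaction of `C^θ` on the free algebra functor given by `B_2(𝟙, -)`. -/
def freeCoactionHom : B.free ⟶ B.free ⋙ (liftComonad (fusionLaw B)).toFunctor where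
  app X := ((comparisonK B).obj X).a
  naturality _ _ f := ((comparisonK B).map f).h.symm

/-- The comonad morphism `T ⟶ C^θ` induced by the coaction of `C^θ` on free algebras. -/
def fusionComonadHom : freeComonad B ⟶ liftComonad (fusionLaw B) :=
  comonadHomOfCoaction B.adj (freeCoactionHom B) (fun X => ((comparisonK B).obj X).counit)
    (fun X => ((comparisonK B).obj X).coassoc)

theorem fusionComonadHom_app_f (Y : B.Algebra) :
    ((fusionComonadHom B).app Y).f = freeCoaction B Y.A ≫ B.obj (𝟙_ A) ◁ Y.a := by
  change freeCoaction B Y.A ≫ B.obj (𝟙_ A) ◁ (B.adj.counit.app Y).f = _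
  rw [adj_counit_app_f]

theorem isIso_fusionComonadHom_app (hB : ∀ X, IsIso (leftFusion B (𝟙_ A) X)) (Y : B.Algebra) :
    IsIso ((fusionComonadHom B).app Y) := by
  have : IsIso ((fusionComonadHom B).app Y).f := by
    rw [fusionComonadHom_app_f]
    exact isIso_coaction_action B hB Y
  exact Monad.algebra_iso_of_iso B _

/-- Naturality of `B_2(𝟙, -)` moves `B η` past the coaction, where it cancels against `μ` by the
unit law. This is what identifies `K` with the comparison functor up to change of comonad. -/
theorem fusionComonadHom_coaction (X : A) :
    ((coalgebraFunctor (fusionComonadHom B)).obj ((Comonad.comparison B.adj).obj X)).a =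
      ((comparisonK B).obj X).a := by
  apply Monad.Algebra.Hom.ext
  change B.map (B.adj.unit.app X) ≫ ((fusionComonadHom B).app (B.free.obj X)).f =
    freeCoaction B X
  rw [fusionComonadHom_app_f, adj_unit_app]
  change B.map (B.η.app X) ≫ freeCoaction B (B.obj X) ≫ B.obj (𝟙_ A) ◁ B.μ.app X = _
  rw [← reassoc_of% (freeCoaction_naturality B (B.η.app X)), ← whiskerLeft_comp, B.right_unit]
  exact (congrArg _ (whiskerLeft_id _ _)).trans (Category.comp_id _)

/-- `K` factors through the comparison functor of the Eilenberg–Moore adjunction. -/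
def comparisonKIso :
    Comonad.comparison B.adj ⋙ coalgebraFunctor (fusionComonadHom B) ≅ comparisonK B :=
  NatIso.ofComponents
    (fun X => Comonad.Coalgebra.isoMk (Iso.refl (B.free.obj X)) (by
      refine (congrArg _ ((liftComonad (fusionLaw B)).map_id _)).trans
        ((Category.comp_id _).trans ?_)
      exact (fusionComonadHom_coaction B X).trans (Category.id_comp _).symm))
    (fun f => Comonad.Coalgebra.Hom.ext
      ((Category.comp_id (B.free.map f)).trans (Category.id_comp (B.free.map f)).symm))

theorem comparisonK_isEquivalence (hB : ∀ X, IsIso (leftFusion B (𝟙_ A) X))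
    (hF : (Comonad.comparison B.adj).IsEquivalence) : (comparisonK B).IsEquivalence := by
  have := isIso_fusionComonadHom_app B hB
  have := isEquivalence_coalgebraFunctor (fusionComonadHom B)
  exact Functor.isEquivalence_of_iso (comparisonKIso B)

end Opmonoidal

end HopfMonads

theorem mainTheorem6 {A : Type u₁} [Category.{v₁} A] [MonoidalCategory A]
    (B : Monad A) [B.toFunctor.OplaxMonoidal] [HopfMonads.IsOpmonoidal B]
    (hB : HopfMonads.IsPreHopf B)
    (hF : (Comonad.comparison B.adj).IsEquivalence) :
    (HopfMonads.comparisonK B).IsEquivalence ∧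
    ∀ (K' : (HopfMonads.liftComonad (HopfMonads.fusionLaw B)).Coalgebra ⥤ A)
      (adj : K' ⊣ HopfMonads.comparisonK B)
      {Z : Type u₂} [Category.{v₂} Z] (N : B.Algebra ⥤ Z),
      Set.BijOn (HopfMonads.conjugateOpcoalgebra B N adj)
        {l | HopfMonads.IsLeftCoalgebra (HopfMonads.chi (HopfMonads.fusionLaw B)) N l}
        {γ | HopfMonads.IsOpcoalgebra
          (HopfMonads.conjugateComonad adj (HopfMonads.extensionComonad (HopfMonads.fusionLaw B)))
          (B.free ⋙ N) γ} := by
  have hK := HopfMonads.comparisonK_isEquivalence B hB.left hF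
  refine ⟨hK, fun K' adj Z _ N => ?_⟩
  -- Since `V K = F` holds definitionally, conjugating a transformation on `N V` gives one on `N F`
  -- with no correction isomorphism.
  have hbij : Function.Bijective (HopfMonads.conjugateOpcoalgebra B N adj) :=
    (HopfMonads.conjugateNabla_bijective adj
      (HopfMonads.extensionComonad (HopfMonads.fusionLaw B))
      ((HopfMonads.liftComonad (HopfMonads.fusionLaw B)).forget ⋙ N)).comp
      (HopfMonads.nabla_bijective (HopfMonads.fusionLaw B) N)
  have hiff (l) : HopfMonads.IsOpcoalgebra
      (HopfMonads.conjugateComonad adj (HopfMonads.extensionComonad (HopfMonads.fusionLaw B)))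
      (B.free ⋙ N) (HopfMonads.conjugateOpcoalgebra B N adj l) ↔
      HopfMonads.IsLeftCoalgebra (HopfMonads.chi (HopfMonads.fusionLaw B)) N l :=
    (HopfMonads.isOpcoalgebra_conjugateNabla_iff adj
      (HopfMonads.extensionComonad (HopfMonads.fusionLaw B))
      ((HopfMonads.liftComonad (HopfMonads.fusionLaw B)).forget ⋙ N) _).trans
      (HopfMonads.isOpcoalgebra_nabla_iff (HopfMonads.fusionLaw B) N l)
  -- The map is bijective on all transformations, and the left coalgebra structures are exactly the
  -- preimage of the opcoalgebra structures.
  refine ⟨fun l hl => (hiff l).2 hl, hbij.injective.injOn, fun γ hγ => ?_⟩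
  obtain ⟨l, rfl⟩ := hbij.surjective γ
  exact ⟨l, (hiff l).1 hγ, rfl⟩
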